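/- Let $H\in(1/2,1)$ and let $(S^H_t)_{t\ge 0}$ be a sub-fractional Brownian motion with Hurst index $H$, i.e. a centred Gaussian process with $S^H_0=0$ almost surely and covariance $$\mathbf E(S^H_sS^H_t)=s^{2H}+t^{2H}-\tfrac12\left(|s-t|^{2H}+(s+t)^{2H}\right).$$ Let $x_0,\theta_0,\mu_0\in\mathbb R$ with $\mu_0+\theta_0x_0\neq 0$. For each $\sigma>0$ let $X^{\sigma}$ be a process which almost surely has continuous paths on $[0,1]$ and satisfies the Vasicek equation $dX_t=(\mu_0+\theta_0X_t)\,dt+\sigma\,dS^H_t$, $X_0=x_0$, that is, $$X^{\sigma}_t=x_0+\int_0^t(\mu_0+\theta_0X^{\sigma}_s)\,ds+\sigma S^H_t,\qquad t\in[0,1].$$ Put $t_i=i/n$ and let the least-squares estimators, i.e. those obtained from the contrast $\sum_{i=1}^n|X_{t_i}-X_{t_{i-1}}-(\mu+\theta X_{t_{i-1}})\frac1n|^2$, be (with $X=X^\sigma$) $$\hat\theta_{n,\sigma}=\frac{\sum_{i=1}^n(X_{t_i}-X_{t_{i-1}})X_{t_{i-1}}-\frac1n\sum_{i=1}^nX_{t_{i-1}}\sum_{i=1}^n(X_{t_i}-X_{t_{i-1}})}{\frac1n\sum_{i=1}^nX_{t_{i-1}}^2-\frac1{n^2}\left(\sum_{i=1}^nX_{t_{i-1}}\right)^2},$$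 $$\hat\mu_{n,\sigma}=\frac{\sum_{i=1}^n(X_{t_i}-X_{t_{i-1}})\sum_{i=1}^nX_{t_{i-1}}^2-\sum_{i=1}^nX_{t_{i-1}}\sum_{i=1}^n(X_{t_i}-X_{t_{i-1}})X_{t_{i-1}}}{\sum_{i=1}^nX_{t_{i-1}}^2-\frac1n\left(\sum_{i=1}^nX_{t_{i-1}}\right)^2}.$$ Then $\hat\theta_{n,\sigma}\to\theta_0$ and $\hat\mu_{n,\sigma}\to\mu_0$ almost surely as $n\to\infty$ and $\sigma\to0^+$, in the following sense. (a) For all deterministic sequences $n_k\to\infty$ in $\mathbb N$ and $\sigma_k\to0^+$, almost surely $\hat\theta_{n_k,\sigma_k}\to\theta_0$, and almost surely $\hat\mu_{n_k,\sigma_k}\to\mu_0$, as $k\to\infty$. (b) If, outside a single null set, the equation holds (with continuous paths) for all $\sigma>0$ simultaneously, then almost surely $\hat\theta_{n,\sigma}\to\theta_0$, and almost surely $\hat\mu_{n,\sigma}\to\mu_0$, as $(n,\sigma)\to(\infty,0^+)$ jointly. -/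

import Mathlib

open MeasureTheory ProbabilityTheory Filter Topology
open scoped NNReal

noncomputable section

/-- Sub-fractional Brownian motion with Hurst index `H`: a centred Gaussian process on `[0, ∞)`,
started at `0`, with covariance `s^{2H} + t^{2H} - (|s - t|^{2H} + (s + t)^{2H}) / 2`. Continuity of
the paths is not part of this definition; in a solution of the equation below it is forced by the
continuity of the solution. -/
structure IsSubfBM {Ω : Type*} [MeasurableSpace Ω] (P : Measure Ω) (H : ℝ)
    (S : ℝ≥0 → Ω → ℝ) : Prop where
  gaussian : IsGaussianProcess S P
  start : ∀ᵐ ω ∂P, S 0 ω = 0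
  mean : ∀ t, ∫ ω, S t ω ∂P = 0
  covariance : ∀ s t, ∫ ω, S t ω * S s ω ∂P =
    (s : ℝ) ^ (2 * H) + (t : ℝ) ^ (2 * H)
      - (1 / 2) * (|(s : ℝ) - t| ^ (2 * H) + ((s : ℝ) + t) ^ (2 * H))

/-- The path `x` solves `dx = (μ + θ x) dt + σ dw`, `x 0 = x₀`, on `[0, 1]`, driven by the path `w`:
it is continuous and satisfies `x t = x₀ + ∫₀ᵗ (μ + θ x s) ds + σ w t`. Only the values of `x` on
`[0, 1]` matter. -/
structure IsVasicekPath (x₀ μ θ σ : ℝ) (w : ℝ≥0 → ℝ) (x : ℝ → ℝ) : Prop where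
  continuousOn : ContinuousOn x (Set.Icc 0 1)
  eqn : ∀ t : ℝ≥0, t ≤ 1 → x t = x₀ + (∫ s in (0 : ℝ)..t, (μ + θ * x s)) + σ * w t

/-- The least-squares contrast of the observations `x (i / n)`; the index `i` here stands for
the step from `t_i = i / n` to `t_{i+1} = (i + 1) / n`. -/
def lsContrast (n : ℕ) (x : ℝ → ℝ) (θ μ : ℝ) : ℝ :=
  ∑ i ∈ Finset.range n,
    |x (((i : ℝ) + 1) / n) - x ((i : ℝ) / n) - (μ + θ * x ((i : ℝ) / n)) * (1 / n)| ^ 2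

/-- `∑ X_{t_{i-1}}` -/
def sumX (n : ℕ) (x : ℝ → ℝ) : ℝ := ∑ i ∈ Finset.range n, x ((i : ℝ) / n)

/-- `∑ X_{t_{i-1}}²` -/
def sumXX (n : ℕ) (x : ℝ → ℝ) : ℝ := ∑ i ∈ Finset.range n, x ((i : ℝ) / n) ^ 2

/-- `∑ (X_{t_i} - X_{t_{i-1}})` -/
def sumDX (n : ℕ) (x : ℝ → ℝ) : ℝ :=
  ∑ i ∈ Finset.range n, (x (((i : ℝ) + 1) / n) - x ((i : ℝ) / n))

/-- `∑ (X_{t_i} - X_{t_{i-1}}) X_{t_{i-1}}` -/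
def sumDXX (n : ℕ) (x : ℝ → ℝ) : ℝ :=
  ∑ i ∈ Finset.range n, (x (((i : ℝ) + 1) / n) - x ((i : ℝ) / n)) * x ((i : ℝ) / n)

/-- The least-squares estimator of `θ` from the observations `x (i / n)`, `0 ≤ i ≤ n`. -/
def thetaHat (n : ℕ) (x : ℝ → ℝ) : ℝ :=
  (sumDXX n x - 1 / n * sumX n x * sumDX n x) /
    (1 / n * sumXX n x - 1 / (n : ℝ) ^ 2 * sumX n x ^ 2)

/-- The least-squares estimator of `μ` from the observations `x (i / n)`, `0 ≤ i ≤ n`. -/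
def muHat (n : ℕ) (x : ℝ → ℝ) : ℝ :=
  (sumDX n x * sumXX n x - sumX n x * sumDXX n x) /
    (sumXX n x - 1 / n * sumX n x ^ 2)

/-- Whenever the denominators do not vanish, the two explicit estimators minimize the contrast. -/
theorem lsContrast_le (n : ℕ) (x : ℝ → ℝ)
    (hd : 1 / n * sumXX n x - 1 / (n : ℝ) ^ 2 * sumX n x ^ 2 ≠ 0) (θ μ : ℝ) :
    lsContrast n x (thetaHat n x) (muHat n x) ≤ lsContrast n x θ μ := by
  have hn : (n : ℝ) ≠ 0 := by
    rintro h
    simp [h] at hd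
  have hd' : sumXX n x - 1 / n * sumX n x ^ 2 ≠ 0 := by
    intro h
    apply hd
    have : 1 / (n : ℝ) * sumXX n x - 1 / (n : ℝ) ^ 2 * sumX n x ^ 2 =
      1 / n * (sumXX n x - 1 / n * sumX n x ^ 2) := by ring
    rw [this, h, mul_zero]
  have hq : (n : ℝ) * sumXX n x - sumX n x ^ 2 ≠ 0 := by
    intro h
    apply hd'
    field_simp
    linarith
  have hth : thetaHat n x =
      n * (n * sumDXX n x - sumX n x * sumDX n x) / (n * sumXX n x - sumX n x ^ 2) := by
    unfold thetaHat
    rw [div_eq_div_iff hd hq]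
    field_simp
  have hmu : muHat n x =
      n * (sumDX n x * sumXX n x - sumX n x * sumDXX n x) / (n * sumXX n x - sumX n x ^ 2) := by
    unfold muHat
    rw [div_eq_div_iff hd' hq]
    field_simp
  -- expansion of the contrast as a quadratic polynomial in the two parameters
  have key : ∀ a b : ℝ, lsContrast n x a b =
      (∑ i ∈ Finset.range n, (x (((i : ℝ) + 1) / n) - x ((i : ℝ) / n)) ^ 2)
        - 2 / n * b * sumDX n x - 2 / n * a * sumDXX n x
        + 1 / (n : ℝ) ^ 2 * (n * b ^ 2 + 2 * a * b * sumX n x + a ^ 2 * sumXX n x) := by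
    intro a b
    have h1 : (n : ℝ) * b ^ 2 = ∑ i ∈ Finset.range n, b ^ 2 := by simp
    unfold lsContrast sumDX sumDXX sumX sumXX
    rw [h1]
    simp only [Finset.mul_sum, ← Finset.sum_add_distrib, ← Finset.sum_sub_distrib]
    refine Finset.sum_congr rfl fun i _ => ?_
    rw [sq_abs]
    ring
  have hsq : 0 ≤ (n : ℝ) * (μ - muHat n x) ^ 2
      + 2 * (θ - thetaHat n x) * (μ - muHat n x) * sumX n x
      + (θ - thetaHat n x) ^ 2 * sumXX n x := by
    have : (n : ℝ) * (μ - muHat n x) ^ 2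
      + 2 * (θ - thetaHat n x) * (μ - muHat n x) * sumX n x
      + (θ - thetaHat n x) ^ 2 * sumXX n x = ∑ i ∈ Finset.range n,
        ((μ - muHat n x) + (θ - thetaHat n x) * x ((i : ℝ) / n)) ^ 2 := by
      have h1 : (n : ℝ) * (μ - muHat n x) ^ 2 =
        ∑ i ∈ Finset.range n, (μ - muHat n x) ^ 2 := by simp
      unfold sumX sumXX
      rw [h1]
      simp only [Finset.mul_sum, ← Finset.sum_add_distrib]
      exact Finset.sum_congr rfl fun i _ => by ring
    rw [this]
    exact Finset.sum_nonneg fun i _ => sq_nonneg _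
  have e1 : (n : ℝ) * muHat n x + thetaHat n x * sumX n x = n * sumDX n x := by
    rw [hth, hmu]
    field_simp
    ring
  have e2 : muHat n x * sumX n x + thetaHat n x * sumXX n x = n * sumDXX n x := by
    rw [hth, hmu]
    field_simp
    ring
  have hD1 : sumDX n x = 1 / n * (n * muHat n x + thetaHat n x * sumX n x) := by
    rw [e1]; field_simp
  have hD2 : sumDXX n x = 1 / n * (muHat n x * sumX n x + thetaHat n x * sumXX n x) := by
    rw [e2]; field_simp
  have hdiff : lsContrast n x θ μ - lsContrast n x (thetaHat n x) (muHat n x) =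
      1 / (n : ℝ) ^ 2 * ((n : ℝ) * (μ - muHat n x) ^ 2
      + 2 * (θ - thetaHat n x) * (μ - muHat n x) * sumX n x
      + (θ - thetaHat n x) ^ 2 * sumXX n x) := by
    rw [key, key]
    generalize muHat n x = m at *
    generalize thetaHat n x = h at *
    rw [hD1, hD2]
    ring
  have : 0 ≤ 1 / (n : ℝ) ^ 2 * ((n : ℝ) * (μ - muHat n x) ^ 2
      + 2 * (θ - thetaHat n x) * (μ - muHat n x) * sumX n x
      + (θ - thetaHat n x) ^ 2 * sumXX n x) := mul_nonneg (by positivity) hsq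
  linarith

end

/-!
Let `y` solve the noiseless equation `y' = μ₀ + θ₀ y`, `y 0 = x₀`. By Grönwall's inequality the
solution at noise level `σ` is uniformly `O(σ)`-close to `y` on `[0, 1]`
(`IsVasicekPath.abs_sub_le`), so `n⁻¹ ∑ X` and `n⁻¹ ∑ X ^ 2` converge to the integrals of `y` and
`y ^ 2`, and `∑ ΔX` telescopes to `y 1 - y 0` in the limit. The one delicate sum is `∑ X ΔX`; by
discrete integration by parts (`sumDXX_eq`) it equals `(X 1 ^ 2 - X 0 ^ 2 - ∑ (ΔX) ^ 2) / 2`, and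
`∑ (ΔX) ^ 2` is at most of order `1 / n + σ ^ 2 ∑ (ΔS) ^ 2` (`IsVasicekPath.sum_sq_sub_le`). Hence
everything passes to the limit as soon as `∑ (ΔS) ^ 2 → 0` as `n → ∞`. In the limit the estimators
become the solution of the normal equations for `y`, which is `(θ₀, μ₀)` because `y' = μ₀ + θ₀ y`
and `y y' = μ₀ y + θ₀ y ^ 2`; the condition `μ₀ + θ₀ x₀ ≠ 0` makes `y` nonconstant, so that the
limiting denominator is positive. This argument is pathwise (`tendsto_thetaHat_muHat`).

Probability enters only through the quadratic variation (`IsSubfBM.ae_tendsto_sum_sq_sub`): by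
convexity of `u ↦ u ^ (2 * H)` the increments of `S` over a step `1 / n` have variance at most
`n ^ (-2 * H)`, so by Gaussian scaling and Jensen's inequality the `p`-th moment of `∑ (ΔS) ^ 2` is
`O(n ^ (-(2 * H - 1) * p))`. Since `H > 1 / 2` this is summable in `n` for large `p`, so the quadratic
variation tends to `0` almost surely along all `n`, and on a single event for all `σ`.
-/

/-! ### Squared increments of sub-fractional Brownian motion -/

/-- By convexity of `u ↦ u ^ (2 * H)`, the increments have variance at most that of fractional
Brownian motion. -/
theorem IsSubfBM.integral_sq_sub_le {Ω : Type*} [MeasurableSpace Ω] {P : Measure Ω} {H : ℝ}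
    {S : ℝ≥0 → Ω → ℝ} (hS : IsSubfBM P H S) (hH : 1 / 2 ≤ H) (s t : ℝ≥0) :
    ∫ ω, (S t ω - S s ω) ^ 2 ∂P ≤ |(t : ℝ) - s| ^ (2 * H) := by
  have hL (u : ℝ≥0) : MemLp (S u) 2 P := (hS.gaussian.hasGaussianLaw_eval u).memLp_two
  have hI (u v : ℝ≥0) : Integrable (fun ω => S u ω * S v ω) P := (hL u).integrable_mul (hL v)
  have hE : ∫ ω, (S t ω - S s ω) ^ 2 ∂P = ∫ ω, S t ω * S t ω ∂P
      - 2 * ∫ ω, S t ω * S s ω ∂P + ∫ ω, S s ω * S s ω ∂P := by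
    rw [← integral_const_mul, ← integral_sub (hI t t) ((hI t s).const_mul 2),
      ← integral_add (f := fun ω => S t ω * S t ω - 2 * (S t ω * S s ω))
        ((hI t t).sub ((hI t s).const_mul 2)) (hI s s)]
    exact integral_congr_ae (.of_forall fun ω => by ring)
  have hdouble (u : ℝ≥0) : ((u : ℝ) + u) ^ (2 * H) = 2 ^ (2 * H) * (u : ℝ) ^ (2 * H) := by
    rw [← two_mul, Real.mul_rpow (by norm_num) u.coe_nonneg]
  have hconv : ((s : ℝ) + t) ^ (2 * H) ≤
      2 ^ (2 * H - 1) * ((s : ℝ) ^ (2 * H) + (t : ℝ) ^ (2 * H)) := by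
    exact_mod_cast NNReal.rpow_add_le_mul_rpow_add_rpow s t (p := 2 * H) (by linarith)
  have h2 : (2 : ℝ) ^ (2 * H) = 2 * 2 ^ (2 * H - 1) := by
    rw [Real.rpow_sub_one (by norm_num)]; ring
  have h0 : (0 : ℝ) ^ (2 * H) = 0 := Real.zero_rpow (by linarith)
  rw [hE, hS.covariance, hS.covariance, hS.covariance, hdouble, hdouble, h2,
    abs_sub_comm (t : ℝ) s]
  simp only [sub_self, abs_zero, h0]
  linarith

/-- Even moments of a centred Gaussian scale like powers of its variance. -/
theorem lintegral_sq_pow_gaussianReal (v : ℝ≥0) (p : ℕ) :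
    ∫⁻ x, ENNReal.ofReal ((x ^ 2) ^ p) ∂gaussianReal 0 v =
      (v : ENNReal) ^ p * ∫⁻ x, ENNReal.ofReal ((x ^ 2) ^ p) ∂gaussianReal 0 1 := by
  have hmap : gaussianReal 0 v = (gaussianReal 0 1).map (fun x => Real.sqrt v * x) := by
    rw [gaussianReal_map_const_mul]
    congr 1
    · simp
    · ext; simp
  rw [hmap, lintegral_map (by fun_prop) (by fun_prop), ← lintegral_const_mul _ (by fun_prop)]
  refine lintegral_congr fun x => ?_
  rw [mul_pow, Real.sq_sqrt v.coe_nonneg, mul_pow, ENNReal.ofReal_mul (by positivity),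
    ENNReal.ofReal_pow v.coe_nonneg, ENNReal.ofReal_coe_nnreal]

theorem lintegral_sq_pow_gaussianReal_ne_top (v : ℝ≥0) (p : ℕ) :
    ∫⁻ x, ENNReal.ofReal ((x ^ 2) ^ p) ∂gaussianReal 0 v ≠ ⊤ := by
  have h : Integrable (fun x : ℝ => x ^ (2 * p)) (gaussianReal 0 v) := by
    have := (memLp_id_gaussianReal' (μ := 0) (v := v) (2 * p : ℕ)
      (ENNReal.natCast_ne_top _)).integrable_norm_pow'
    refine this.congr (.of_forall fun x => ?_)
    simp only [id, Real.norm_eq_abs]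
    exact (even_two_mul p).pow_abs x
  simp only [← pow_mul]
  rw [← ofReal_integral_eq_lintegral_ofReal h (.of_forall fun x => (even_two_mul p).pow_nonneg x)]
  exact ENNReal.ofReal_ne_top

theorem IsSubfBM.lintegral_sq_sub_pow_le {Ω : Type*} [MeasurableSpace Ω] {P : Measure Ω} {H : ℝ}
    {S : ℝ≥0 → Ω → ℝ} (hS : IsSubfBM P H S) (hH : 1 / 2 ≤ H) (p : ℕ) (s t : ℝ≥0) :
    ∫⁻ ω, ENNReal.ofReal (((S t ω - S s ω) ^ 2) ^ p) ∂P ≤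
      ENNReal.ofReal (|(t : ℝ) - s| ^ (2 * H)) ^ p *
        ∫⁻ x, ENNReal.ofReal ((x ^ 2) ^ p) ∂gaussianReal 0 1 := by
  have hG : HasGaussianLaw (fun ω => S t ω - S s ω) P := hS.gaussian.hasGaussianLaw_fun_sub
  have hmean : ∫ ω, (S t ω - S s ω) ∂P = 0 := by
    rw [integral_sub (hS.gaussian.hasGaussianLaw_eval t).integrable
      (hS.gaussian.hasGaussianLaw_eval s).integrable, hS.mean, hS.mean, sub_zero]
  have hvar : Var[fun ω => S t ω - S s ω; P] ≤ |(t : ℝ) - s| ^ (2 * H) := by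
    rw [variance_of_integral_eq_zero hG.aemeasurable hmean]
    exact hS.integral_sq_sub_le hH s t
  have hmap := hG.map_eq_gaussianReal
  rw [hmean] at hmap
  rw [← lintegral_map' (f := fun x : ℝ => ENNReal.ofReal ((x ^ 2) ^ p)) (by fun_prop)
    hG.aemeasurable, hmap, lintegral_sq_pow_gaussianReal]
  gcongr
  exact ENNReal.ofReal_le_ofReal hvar

/-- The quadratic variation of sub-fractional Brownian motion along the uniform partitions of
`[0, 1]` vanishes almost surely when `H > 1 / 2`: its `p`-th moment is `O(n ^ (-(2 * H - 1) * p))`,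
which is summable in `n` once `p` is large. -/
theorem IsSubfBM.ae_tendsto_sum_sq_sub {Ω : Type*} [MeasurableSpace Ω] {P : Measure Ω} {H : ℝ}
    {S : ℝ≥0 → Ω → ℝ} (hS : IsSubfBM P H S) (hH : 1 / 2 < H) :
    ∀ᵐ ω ∂P, Tendsto (fun n : ℕ => ∑ i ∈ Finset.range n,
      (S (((i : ℝ≥0) + 1) / n) ω - S ((i : ℝ≥0) / n) ω) ^ 2) atTop (𝓝 0) := by
  obtain ⟨p, hp⟩ := exists_nat_gt (1 / (2 * H - 1))
  have hH' : 0 < 2 * H - 1 := by linarith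
  rw [div_lt_iff₀ hH'] at hp
  have hp0 : p ≠ 0 := by
    rintro rfl
    norm_num at hp
  set Q : ℕ → Ω → ℝ := fun n ω => ∑ i ∈ Finset.range n,
      (S (((i : ℝ≥0) + 1) / n) ω - S ((i : ℝ≥0) / n) ω) ^ 2 with hQ
  set C := ∫⁻ x, ENNReal.ofReal ((x ^ 2) ^ p) ∂gaussianReal 0 1 with hC
  have hCtop : C ≠ ⊤ := lintegral_sq_pow_gaussianReal_ne_top 1 p
  have hmeas (t s : ℝ≥0) : AEMeasurable (fun ω => ENNReal.ofReal (((S t ω - S s ω) ^ 2) ^ p)) P :=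
    (((hS.gaussian.aemeasurable t).sub (hS.gaussian.aemeasurable s)).pow_const 2
      |>.pow_const p).ennreal_ofReal
  have hmeasQ (n : ℕ) : AEMeasurable (fun ω => ENNReal.ofReal (Q n ω ^ p)) P := by
    refine (AEMeasurable.pow_const ?_ p).ennreal_ofReal
    exact Finset.aemeasurable_fun_sum _ fun i _ =>
      ((hS.gaussian.aemeasurable _).sub (hS.gaussian.aemeasurable _)).pow_const 2
  have hmoment (n : ℕ) : ∫⁻ ω, ENNReal.ofReal (Q n ω ^ p) ∂P ≤
      ENNReal.ofReal ((n : ℝ) ^ (-((2 * H - 1) * p))) * C := by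
    rcases Nat.eq_zero_or_pos n with rfl | hn
    · simp [hQ, hp0]
    have hn' : (0 : ℝ) < n := by exact_mod_cast hn
    have hjensen (ω : Ω) : ENNReal.ofReal (Q n ω ^ p) ≤ ENNReal.ofReal ((n : ℝ) ^ (p - 1)) *
        ∑ i ∈ Finset.range n, ENNReal.ofReal
          (((S (((i : ℝ≥0) + 1) / n) ω - S ((i : ℝ≥0) / n) ω) ^ 2) ^ p) := by
      rw [← ENNReal.ofReal_sum_of_nonneg (fun i _ => by positivity),
        ← ENNReal.ofReal_mul (by positivity)]
      refine ENNReal.ofReal_le_ofReal ?_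
      have := pow_sum_div_card_le_sum_pow (s := Finset.range n) (fun i _ =>
        sq_nonneg (S (((i : ℝ≥0) + 1) / n) ω - S ((i : ℝ≥0) / n) ω)) (p - 1)
      rw [Nat.sub_add_cancel (Nat.pos_of_ne_zero hp0), Finset.card_range,
        div_le_iff₀' (by positivity)] at this
      exact this
    calc ∫⁻ ω, ENNReal.ofReal (Q n ω ^ p) ∂P
        ≤ ENNReal.ofReal ((n : ℝ) ^ (p - 1)) * ∑ i ∈ Finset.range n, ∫⁻ ω, ENNReal.ofReal
          (((S (((i : ℝ≥0) + 1) / n) ω - S ((i : ℝ≥0) / n) ω) ^ 2) ^ p) ∂P := by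
          rw [← lintegral_finsetSum' _ fun i _ => hmeas _ _,
            ← lintegral_const_mul' _ _ ENNReal.ofReal_ne_top]
          exact lintegral_mono hjensen
      _ ≤ ENNReal.ofReal ((n : ℝ) ^ (p - 1)) * ∑ i ∈ Finset.range n,
          ENNReal.ofReal ((1 / n : ℝ) ^ (2 * H)) ^ p * C := by
          gcongr with i hi
          refine (hS.lintegral_sq_sub_pow_le hH.le p _ _).trans_eq ?_
          congr 4
          have : (((((i : ℝ≥0) + 1) / n : ℝ≥0) : ℝ) - ((i : ℝ≥0) / n : ℝ≥0)) = 1 / n := by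
            push_cast
            ring
          rw [this, abs_of_nonneg (by positivity)]
      _ = _ := by
          rw [Finset.sum_const, Finset.card_range, nsmul_eq_mul, ← ENNReal.ofReal_natCast,
            ← ENNReal.ofReal_pow (by positivity), ← mul_assoc, ← mul_assoc,
            ← ENNReal.ofReal_mul (by positivity), ← ENNReal.ofReal_mul (by positivity), ← pow_succ,
            Nat.sub_add_cancel (Nat.pos_of_ne_zero hp0)]
          congr 2
          rw [one_div, Real.inv_rpow hn'.le, ← Real.rpow_neg hn'.le, ← Real.rpow_natCast _ p,
            ← Real.rpow_natCast _ p, ← Real.rpow_mul hn'.le, ← Real.rpow_add hn']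
          congr 1
          ring
  have hsum : ∫⁻ ω, ∑' n, ENNReal.ofReal (Q n ω ^ p) ∂P ≠ ⊤ := by
    rw [lintegral_tsum hmeasQ]
    refine ne_top_of_le_ne_top ?_ (ENNReal.tsum_le_tsum hmoment)
    rw [ENNReal.tsum_mul_right]
    refine ENNReal.mul_ne_top ?_ hCtop
    refine Summable.tsum_ofReal_ne_top (Real.summable_nat_rpow.2 ?_)
    linarith
  filter_upwards [ae_lt_top' (AEMeasurable.tsum hmeasQ) hsum] with ω hω
  have h1 := ENNReal.tendsto_atTop_zero_of_tsum_ne_top hω.ne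
  have hQ0 (n : ℕ) : 0 ≤ Q n ω := Finset.sum_nonneg fun i _ => sq_nonneg _
  have h2 : Tendsto (fun n => Q n ω ^ p) atTop (𝓝 0) := by
    have := (ENNReal.tendsto_toReal ENNReal.zero_ne_top).comp h1
    refine this.congr fun n => ?_
    simp [ENNReal.toReal_ofReal (pow_nonneg (hQ0 n) p)]
  have h3 := h2.rpow_const (p := (p : ℝ)⁻¹) (Or.inr (by positivity))
  rw [Real.zero_rpow (by simpa using hp0)] at h3
  exact h3.congr fun n => Real.pow_rpow_inv_natCast (hQ0 n) hp0

/-! ### Sums over the uniform partition of the unit interval -/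

theorem div_natCast_mem_Icc {n i : ℕ} (hi : i < n) : (i : ℝ) / n ∈ Set.Icc (0 : ℝ) 1 :=
  ⟨by positivity, div_le_one_of_le₀ (by exact_mod_cast hi.le) (by positivity)⟩

theorem add_one_div_natCast_mem_Icc {n i : ℕ} (hi : i < n) :
    ((i : ℝ) + 1) / n ∈ Set.Icc (0 : ℝ) 1 :=
  ⟨by positivity, div_le_one_of_le₀ (by exact_mod_cast hi) (by positivity)⟩

theorem uIcc_div_natCast_subset {n i : ℕ} (hi : i < n) :
    Set.uIcc ((i : ℝ) / n) (((i : ℝ) + 1) / n) ⊆ Set.Icc 0 1 :=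
  Set.uIcc_subset_Icc (div_natCast_mem_Icc hi) (add_one_div_natCast_mem_Icc hi)

theorem abs_mean_sub_mean_le {n : ℕ} {f g : ℕ → ℝ} {ε : ℝ} (hε : 0 ≤ ε)
    (h : ∀ i < n, |f i - g i| ≤ ε) :
    |1 / (n : ℝ) * ∑ i ∈ Finset.range n, f i - 1 / (n : ℝ) * ∑ i ∈ Finset.range n, g i| ≤ ε := by
  rcases Nat.eq_zero_or_pos n with rfl | hn
  · simpa using hε
  have hn' : (0 : ℝ) < n := by exact_mod_cast hn
  rw [← mul_sub, ← Finset.sum_sub_distrib, abs_mul, abs_of_pos (by positivity : 0 < 1 / (n : ℝ))]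
  calc 1 / (n : ℝ) * |∑ i ∈ Finset.range n, (f i - g i)|
      ≤ 1 / (n : ℝ) * ∑ i ∈ Finset.range n, ε := by
        gcongr
        exact (Finset.abs_sum_le_sum_abs _ _).trans
          (Finset.sum_le_sum fun i hi => h i (Finset.mem_range.1 hi))
    _ = ε := by simp [hn'.ne']

theorem tendsto_mean_integral {f : ℝ → ℝ} (hf : Continuous f) :
    Tendsto (fun n : ℕ => 1 / (n : ℝ) * ∑ i ∈ Finset.range n, f ((i : ℝ) / n)) atTop
      (𝓝 (∫ t in (0 : ℝ)..1, f t)) := by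
  rw [Metric.tendsto_atTop]
  intro ε hε
  obtain ⟨δ, hδ, huc⟩ := Metric.uniformContinuousOn_iff.1
    (isCompact_Icc.uniformContinuousOn_of_continuous (s := Set.Icc (0 : ℝ) 1) hf.continuousOn)
    (ε / 2) (half_pos hε)
  obtain ⟨N, hN⟩ := exists_nat_one_div_lt hδ
  refine ⟨N + 1, fun n hn => ?_⟩
  have hn0 : (0 : ℝ) < n := by exact_mod_cast (by omega : 0 < n)
  have hnδ : 1 / (n : ℝ) < δ := by
    refine lt_of_le_of_lt ?_ hN
    gcongr
    exact_mod_cast hn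
  have hsplit : ∫ t in (0 : ℝ)..1, f t = 1 / (n : ℝ) * ∑ i ∈ Finset.range n,
      n * ∫ t in ((i : ℝ) / n)..(((i : ℝ) + 1) / n), f t := by
    have := intervalIntegral.sum_integral_adjacent_intervals (μ := volume) (f := f) (n := n)
      (a := fun i : ℕ => (i : ℝ) / n) fun k _ => hf.intervalIntegrable _ _
    simp only [Nat.cast_zero, zero_div, div_self hn0.ne', Nat.cast_add, Nat.cast_one] at this
    rw [← Finset.mul_sum, this]
    field_simp
  rw [hsplit, Real.dist_eq]
  refine (abs_mean_sub_mean_le (half_pos hε).le fun i hi => ?_).trans_lt (half_lt_self hε)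
  have hlen : ((i : ℝ) + 1) / n - (i : ℝ) / n = 1 / n := by ring
  have hcell : f ((i : ℝ) / n) - n * ∫ t in ((i : ℝ) / n)..(((i : ℝ) + 1) / n), f t =
      n * ∫ t in ((i : ℝ) / n)..(((i : ℝ) + 1) / n), (f ((i : ℝ) / n) - f t) := by
    rw [intervalIntegral.integral_sub (by simp) (hf.intervalIntegrable _ _),
      intervalIntegral.integral_const, hlen, smul_eq_mul]
    field_simp
  have hbound := intervalIntegral.norm_integral_le_of_norm_le_const (C := ε / 2)
    (a := (i : ℝ) / n) (b := ((i : ℝ) + 1) / n) (f := fun t => f ((i : ℝ) / n) - f t) fun t ht => by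
      have ht' := uIcc_div_natCast_subset hi (Set.uIoc_subset_uIcc ht)
      rw [Set.uIoc_of_le (by gcongr; linarith)] at ht
      refine (huc _ (div_natCast_mem_Icc hi) t ht' ?_).le
      rw [Real.dist_eq, abs_sub_comm, abs_of_pos (by linarith [ht.1])]
      linarith [ht.2]
  rw [hlen, abs_of_pos (by positivity), Real.norm_eq_abs] at hbound
  rw [hcell, abs_mul, abs_of_pos hn0]
  calc (n : ℝ) * _ ≤ n * (ε / 2 * (1 / n)) := by gcongr
    _ = ε / 2 := by field_simp

theorem sumDX_eq {n : ℕ} (hn : n ≠ 0) (x : ℝ → ℝ) : sumDX n x = x 1 - x 0 := by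
  have hn' : (n : ℝ) ≠ 0 := by exact_mod_cast hn
  have := Finset.sum_range_sub (fun i : ℕ => x ((i : ℝ) / n)) n
  simpa [sumDX, hn'] using this

/-- Discrete integration by parts: the stochastic sum is a boundary term minus half the sum of
the squared increments. -/
theorem sumDXX_eq {n : ℕ} (hn : n ≠ 0) (x : ℝ → ℝ) :
    sumDXX n x = (x 1 ^ 2 - x 0 ^ 2
      - ∑ i ∈ Finset.range n, (x (((i : ℝ) + 1) / n) - x ((i : ℝ) / n)) ^ 2) / 2 := by
  have hn' : (n : ℝ) ≠ 0 := by exact_mod_cast hn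
  have h := sumDX_eq hn fun t => x t ^ 2
  rw [← h, sumDX, sumDXX, ← Finset.sum_sub_distrib, Finset.sum_div]
  exact Finset.sum_congr rfl fun i _ => by ring

/-! ### The noiseless equation -/

/-- The solution is written with an integral of `exp (θ * s)` so that `θ = 0` needs no separate
treatment. -/
theorem exists_hasDerivAt_affine (x₀ μ θ : ℝ) :
    ∃ y : ℝ → ℝ, y 0 = x₀ ∧ ∀ t, HasDerivAt y (μ + θ * y t) t := by
  have hc : Continuous fun s : ℝ => Real.exp (θ * s) := by fun_prop
  have hexp (t : ℝ) : θ * ∫ s in (0 : ℝ)..t, Real.exp (θ * s) = Real.exp (θ * t) - 1 := by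
    rw [← intervalIntegral.integral_const_mul,
      intervalIntegral.integral_eq_sub_of_hasDerivAt (f := fun s => Real.exp (θ * s))
        (fun s _ => ?_) ((hc.const_mul θ).intervalIntegrable _ _)]
    · simp
    · simpa [mul_comm] using ((hasDerivAt_id s).const_mul θ).exp
  refine ⟨fun t => x₀ + (μ + θ * x₀) * ∫ s in (0 : ℝ)..t, Real.exp (θ * s), by simp, fun t => ?_⟩
  have h := ((hc.integral_hasStrictDerivAt 0 t).hasDerivAt.const_mul (μ + θ * x₀)).const_add x₀
  refine h.congr_deriv ?_
  linear_combination -(μ + θ * x₀) * hexp t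

/-- The variance of a nonconstant continuous function on the unit interval is positive. -/
theorem integral_sq_sub_sq_integral_pos {y : ℝ → ℝ} (hy : Continuous y)
    (h : ∃ t ∈ Set.Icc (0 : ℝ) 1, y t ≠ y 0) :
    0 < (∫ t in (0 : ℝ)..1, y t ^ 2) - (∫ t in (0 : ℝ)..1, y t) ^ 2 := by
  set m := ∫ t in (0 : ℝ)..1, y t with hm
  have hI : IntervalIntegrable y volume 0 1 := hy.intervalIntegrable _ _
  have hI2 : IntervalIntegrable (fun t => y t ^ 2) volume 0 1 := (hy.pow 2).intervalIntegrable _ _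
  have hvar : (∫ t in (0 : ℝ)..1, y t ^ 2) - m ^ 2 = ∫ t in (0 : ℝ)..1, (y t - m) ^ 2 := by
    have h1 : ∀ t, (y t - m) ^ 2 = y t ^ 2 - 2 * m * y t + m ^ 2 := fun t => by ring
    simp only [h1]
    rw [intervalIntegral.integral_add (hI2.sub (hI.const_mul _)) (by simp),
      intervalIntegral.integral_sub hI2 (hI.const_mul _), intervalIntegral.integral_const_mul,
      intervalIntegral.integral_const, ← hm]
    simp only [smul_eq_mul]
    ring
  rw [hvar]
  have hex : ∃ c ∈ Set.Icc (0 : ℝ) 1, 0 < (y c - m) ^ 2 := by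
    obtain ⟨t, ht, hne⟩ := h
    by_cases h0 : y 0 = m
    · exact ⟨t, ht, sq_pos_of_ne_zero fun h' => hne (by linarith)⟩
    · exact ⟨0, by simp, sq_pos_of_ne_zero (sub_ne_zero.2 h0)⟩
  exact intervalIntegral.integral_pos zero_lt_one (by fun_prop) (fun t _ => sq_nonneg _) hex

theorem exists_ne_of_hasDerivAt_ne_zero {y : ℝ → ℝ} {c : ℝ} (hy : HasDerivAt y c 0) (hc : c ≠ 0) :
    ∃ t ∈ Set.Icc (0 : ℝ) 1, y t ≠ y 0 := by
  by_contra! h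
  refine hc ((uniqueDiffOn_Icc_zero_one 0 (by simp)).eq_deriv _ hy.hasDerivWithinAt ?_)
  exact (hasDerivWithinAt_const (0 : ℝ) (Set.Icc (0 : ℝ) 1) (y 0)).congr h rfl

/-! ### Solutions of the Vasicek equation, path by path -/

theorem IsVasicekPath.eqn_toNNReal {x₀ μ θ σ : ℝ} {w : ℝ≥0 → ℝ} {x : ℝ → ℝ}
    (hx : IsVasicekPath x₀ μ θ σ w x) {t : ℝ} (ht : t ∈ Set.Icc (0 : ℝ) 1) :
    x t = x₀ + (∫ s in (0 : ℝ)..t, (μ + θ * x s)) + σ * w t.toNNReal := by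
  have := hx.eqn t.toNNReal (Real.toNNReal_le_one.2 ht.2)
  rwa [Real.coe_toNNReal _ ht.1] at this

theorem IsVasicekPath.intervalIntegrable {x₀ μ θ σ : ℝ} {w : ℝ≥0 → ℝ} {x : ℝ → ℝ}
    (hx : IsVasicekPath x₀ μ θ σ w x) {a b : ℝ} (ha : a ∈ Set.Icc (0 : ℝ) 1)
    (hb : b ∈ Set.Icc (0 : ℝ) 1) : IntervalIntegrable (fun s => μ + θ * x s) volume a b :=
  ((continuousOn_const.add (hx.continuousOn.const_mul θ)).mono
    (Set.uIcc_subset_Icc ha hb)).intervalIntegrable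

/-- A path that drives a solution is bounded on `[0, 1]`: the equation expresses it through the
continuous solution. -/
theorem IsVasicekPath.exists_abs_le {x₀ μ θ σ : ℝ} {w : ℝ≥0 → ℝ} {x : ℝ → ℝ}
    (hx : IsVasicekPath x₀ μ θ σ w x) (hσ : 0 < σ) :
    ∃ M, ∀ t ∈ Set.Icc (0 : ℝ) 1, |w t.toNNReal| ≤ M := by
  have hc : ContinuousOn (fun t => (x t - x₀ - ∫ s in (0 : ℝ)..t, (μ + θ * x s)) / σ)
      (Set.Icc 0 1) := by
    refine ((hx.continuousOn.sub continuousOn_const).sub ?_).div_const σ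
    have := intervalIntegral.continuousOn_primitive_interval (μ := volume) (a := (0 : ℝ)) (b := 1)
      (f := fun s => μ + θ * x s) ?_
    · rwa [Set.uIcc_of_le zero_le_one] at this
    · rw [Set.uIcc_of_le zero_le_one]
      exact (continuousOn_const.add (hx.continuousOn.const_mul θ)).integrableOn_Icc
  obtain ⟨M, hM⟩ := isCompact_Icc.exists_bound_of_continuousOn hc
  refine ⟨M, fun t ht => ?_⟩
  convert hM t ht using 1
  rw [Real.norm_eq_abs]
  congr 1
  rw [hx.eqn_toNNReal ht]
  field_simp
  ring

/-- Grönwall's inequality for the distance between the solution and the solution `y` of the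
noiseless equation. -/
theorem IsVasicekPath.abs_sub_le {x₀ μ θ σ : ℝ} {w : ℝ≥0 → ℝ} {x y : ℝ → ℝ}
    (hx : IsVasicekPath x₀ μ θ σ w x) (hσ : 0 ≤ σ) (hy0 : y 0 = x₀)
    (hy : ∀ t, HasDerivAt y (μ + θ * y t) t) {M : ℝ}
    (hM : ∀ t ∈ Set.Icc (0 : ℝ) 1, |w t.toNNReal| ≤ M) :
    ∀ t ∈ Set.Icc (0 : ℝ) 1, |x t - y t| ≤ |θ| * gronwallBound 0 |θ| (σ * M) 1 + σ * M := by
  have hyc : Continuous y := continuous_iff_continuousAt.2 fun t => (hy t).continuousAt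
  have hyeq (t : ℝ) : y t = x₀ + ∫ s in (0 : ℝ)..t, (μ + θ * y s) := by
    rw [intervalIntegral.integral_eq_sub_of_hasDerivAt (fun s _ => hy s)
      ((by fun_prop : Continuous fun s => μ + θ * y s).intervalIntegrable _ _), hy0]
    ring
  -- a continuous extension of `x - y` beyond `[0, 1]`
  set z : ℝ → ℝ := Set.IccExtend zero_le_one ((Set.Icc (0 : ℝ) 1).domRestrict fun t => x t - y t)
    with hz
  have hzc : Continuous z :=
    (continuousOn_iff_continuous_domRestrict.1 (hx.continuousOn.sub hyc.continuousOn)).Icc_extend'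
  have hzeq {t : ℝ} (ht : t ∈ Set.Icc (0 : ℝ) 1) : z t = x t - y t := by
    rw [hz, Set.IccExtend_of_mem _ _ ht, Set.domRestrict_apply]
  have hdiff {t : ℝ} (ht : t ∈ Set.Icc (0 : ℝ) 1) :
      z t = θ * (∫ s in (0 : ℝ)..t, z s) + σ * w t.toNNReal := by
    have h1 : θ * (∫ s in (0 : ℝ)..t, z s) = (∫ s in (0 : ℝ)..t, (μ + θ * x s)) -
        ∫ s in (0 : ℝ)..t, (μ + θ * y s) := by
      rw [← intervalIntegral.integral_const_mul, ← intervalIntegral.integral_sub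
        (hx.intervalIntegrable (by simp) ht)
        ((by fun_prop : Continuous fun s => μ + θ * y s).intervalIntegrable _ _)]
      refine intervalIntegral.integral_congr fun s hs => ?_
      simp only [hzeq (Set.uIcc_subset_Icc (by simp) ht hs)]
      ring
    rw [h1, hzeq ht, hx.eqn_toNNReal ht, hyeq t]
    ring
  have hM0 : 0 ≤ M := (abs_nonneg _).trans (hM 0 (by simp))
  have hbound {t : ℝ} (ht : t ∈ Set.Icc (0 : ℝ) 1) :
      |z t| ≤ |θ| * |∫ s in (0 : ℝ)..t, z s| + σ * M := by
    rw [hdiff ht, ← abs_mul]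
    refine (abs_add_le _ _).trans ?_
    rw [abs_mul σ, abs_of_nonneg hσ]
    gcongr
    exact hM t ht
  have hder (t : ℝ) : HasDerivAt (fun t => ∫ s in (0 : ℝ)..t, z s) (z t) t :=
    (hzc.integral_hasStrictDerivAt 0 t).hasDerivAt
  intro t ht
  have hgron := norm_le_gronwallBound_of_norm_deriv_right_le (K := |θ|) (ε := σ * M) (δ := 0)
    (fun t _ => (hder t).continuousAt.continuousWithinAt) (fun t _ => (hder t).hasDerivWithinAt)
    (by simp) (fun t ht => hbound (Set.Ico_subset_Icc_self ht)) t ht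
  rw [← hzeq ht]
  refine (hbound ht).trans ?_
  gcongr
  refine hgron.trans (gronwallBound_mono le_rfl (by positivity) (abs_nonneg _) ?_)
  linarith [ht.2]

theorem IsVasicekPath.sub_eq {x₀ μ θ σ : ℝ} {w : ℝ≥0 → ℝ} {x : ℝ → ℝ}
    (hx : IsVasicekPath x₀ μ θ σ w x) {n i : ℕ} (hi : i < n) :
    x (((i : ℝ) + 1) / n) - x ((i : ℝ) / n) =
      (∫ s in ((i : ℝ) / n)..(((i : ℝ) + 1) / n), (μ + θ * x s)) +
        σ * (w (((i : ℝ≥0) + 1) / n) - w ((i : ℝ≥0) / n)) := by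
  have h0 : (0 : ℝ) ∈ Set.Icc (0 : ℝ) 1 := by simp
  have ha := div_natCast_mem_Icc hi
  have hb := add_one_div_natCast_mem_Icc hi
  have h1 := hx.eqn (((i : ℝ≥0) + 1) / n) (by exact_mod_cast hb.2)
  have h2 := hx.eqn ((i : ℝ≥0) / n) (by exact_mod_cast ha.2)
  push_cast at h1 h2
  rw [h1, h2, ← intervalIntegral.integral_interval_sub_left (hx.intervalIntegrable h0 hb)
    (hx.intervalIntegrable h0 ha)]
  ring

theorem IsVasicekPath.sum_sq_sub_le {x₀ μ θ σ : ℝ} {w : ℝ≥0 → ℝ} {x : ℝ → ℝ}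
    (hx : IsVasicekPath x₀ μ θ σ w x) {K : ℝ}
    (hK : ∀ t ∈ Set.Icc (0 : ℝ) 1, |μ + θ * x t| ≤ K) (n : ℕ) :
    ∑ i ∈ Finset.range n, (x (((i : ℝ) + 1) / n) - x ((i : ℝ) / n)) ^ 2 ≤
      2 * (K ^ 2 * (1 / n)) + 2 * (σ ^ 2 * ∑ i ∈ Finset.range n,
        (w (((i : ℝ≥0) + 1) / n) - w ((i : ℝ≥0) / n)) ^ 2) := by
  have hterm (i : ℕ) (hi : i ∈ Finset.range n) : (x (((i : ℝ) + 1) / n) - x ((i : ℝ) / n)) ^ 2 ≤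
      2 * (K ^ 2 * (1 / n) ^ 2) +
        2 * (σ ^ 2 * (w (((i : ℝ≥0) + 1) / n) - w ((i : ℝ≥0) / n)) ^ 2) := by
    rw [Finset.mem_range] at hi
    have hdrift := intervalIntegral.norm_integral_le_of_norm_le_const (C := K)
      (f := fun s => μ + θ * x s) (a := (i : ℝ) / n) (b := ((i : ℝ) + 1) / n) fun t ht =>
        hK t (uIcc_div_natCast_subset hi (Set.uIoc_subset_uIcc ht))
    rw [show ((i : ℝ) + 1) / n - (i : ℝ) / n = 1 / n by ring, abs_of_nonneg (by positivity)]
      at hdrift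
    have hdrift2 := sq_le_sq' (abs_le.1 hdrift).1 (abs_le.1 hdrift).2
    rw [hx.sub_eq hi]
    refine add_sq_le.trans ?_
    rw [mul_pow σ, ← mul_pow K, mul_add]
    gcongr
  refine (Finset.sum_le_sum hterm).trans_eq ?_
  rw [Finset.sum_add_distrib, Finset.sum_const, Finset.card_range, nsmul_eq_mul, Finset.mul_sum,
    Finset.mul_sum]
  rcases Nat.eq_zero_or_pos n with rfl | hn
  · simp
  · have : (n : ℝ) ≠ 0 := by positivity
    congr 1
    field_simp

/-! ### Consistency along a filter -/

/-- The least-squares estimators converge path by path, along any filter on which `n → ∞` and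
`σ → 0+`, once the quadratic variation of the driving path along uniform partitions vanishes. -/
theorem tendsto_thetaHat_muHat {ι : Type*} {l : Filter ι} [l.NeBot] {x₀ μ θ : ℝ}
    (hnd : μ + θ * x₀ ≠ 0) {w : ℝ≥0 → ℝ}
    (hw : Tendsto (fun n : ℕ => ∑ i ∈ Finset.range n,
      (w (((i : ℝ≥0) + 1) / n) - w ((i : ℝ≥0) / n)) ^ 2) atTop (𝓝 0))
    {N : ι → ℕ} (hN : Tendsto N l atTop) {σ : ι → ℝ} (hσ : Tendsto σ l (𝓝[>] 0))
    {x : ι → ℝ → ℝ} (hx : ∀ᶠ k in l, IsVasicekPath x₀ μ θ (σ k) w (x k)) :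
    Tendsto (fun k => thetaHat (N k) (x k)) l (𝓝 θ) ∧
      Tendsto (fun k => muHat (N k) (x k)) l (𝓝 μ) := by
  obtain ⟨y, hy0, hy⟩ := exists_hasDerivAt_affine x₀ μ θ
  have hyc : Continuous y := continuous_iff_continuousAt.2 fun t => (hy t).continuousAt
  have hyc2 : Continuous fun t => y t ^ 2 := hyc.pow 2
  have hσpos : ∀ᶠ k in l, 0 < σ k := hσ.eventually self_mem_nhdsWithin
  have hσ0 : Tendsto σ l (𝓝 0) := hσ.mono_right nhdsWithin_le_nhds
  have hNpos : ∀ᶠ k in l, N k ≠ 0 := hN.eventually (eventually_ne_atTop 0)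
  obtain ⟨M, hM⟩ : ∃ M, ∀ t ∈ Set.Icc (0 : ℝ) 1, |w t.toNNReal| ≤ M := by
    obtain ⟨k, hk, hk'⟩ := (hx.and hσpos).exists
    exact hk.exists_abs_le hk'
  obtain ⟨R, hR⟩ := isCompact_Icc.exists_bound_of_continuousOn
    (hyc.continuousOn (s := Set.Icc (0 : ℝ) 1))
  simp only [Real.norm_eq_abs] at hR
  have hR0 : 0 ≤ R := (abs_nonneg _).trans (hR 0 (by simp))
  -- uniform convergence of the solutions to `y`
  set δ : ι → ℝ := fun k => |θ| * gronwallBound 0 |θ| (σ k * M) 1 + σ k * M with hδ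
  have hδ0 : Tendsto δ l (𝓝 0) := by
    have hσM : Tendsto (fun k => σ k * M) l (𝓝 0) := by simpa using hσ0.mul_const M
    have hg := ((gronwallBound_continuous_ε 0 |θ| 1).tendsto 0).comp hσM
    rw [gronwallBound_ε0_δ0] at hg
    simpa using (hg.const_mul |θ|).add hσM
  have hclose : ∀ᶠ k in l, ∀ t ∈ Set.Icc (0 : ℝ) 1, |x k t - y t| ≤ δ k := by
    filter_upwards [hx, hσpos] with k hk hk'
    exact hk.abs_sub_le hk'.le hy0 hy hM
  have hδnonneg : ∀ᶠ k in l, 0 ≤ δ k := by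
    filter_upwards [hclose] with k hk
    exact (abs_nonneg _).trans (hk 0 (by simp))
  have hpoint {t : ℝ} (ht : t ∈ Set.Icc (0 : ℝ) 1) : Tendsto (fun k => x k t) l (𝓝 (y t)) := by
    rw [tendsto_iff_dist_tendsto_zero]
    refine squeeze_zero' (.of_forall fun _ => dist_nonneg) ?_ hδ0
    filter_upwards [hclose] with k hk
    exact hk t ht
  have h0 : (0 : ℝ) ∈ Set.Icc (0 : ℝ) 1 := by simp
  have h1 : (1 : ℝ) ∈ Set.Icc (0 : ℝ) 1 := by simp
  -- the four sums
  have hS : Tendsto (fun k => 1 / (N k : ℝ) * sumX (N k) (x k)) l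
      (𝓝 (∫ t in (0 : ℝ)..1, y t)) := by
    refine ((tendsto_mean_integral hyc).comp hN).congr_dist ?_
    refine squeeze_zero' (.of_forall fun _ => dist_nonneg) ?_ hδ0
    filter_upwards [hclose, hδnonneg] with k hk hk'
    rw [dist_comm]
    exact abs_mean_sub_mean_le hk' fun i hi => hk _ (div_natCast_mem_Icc hi)
  have hSS : Tendsto (fun k => 1 / (N k : ℝ) * sumXX (N k) (x k)) l
      (𝓝 (∫ t in (0 : ℝ)..1, y t ^ 2)) := by
    refine ((tendsto_mean_integral hyc2).comp hN).congr_dist ?_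
    have hlim : Tendsto (fun k => δ k * (δ k + 2 * R)) l (𝓝 0) := by
      simpa using hδ0.mul (hδ0.add_const (2 * R))
    refine squeeze_zero' (.of_forall fun _ => dist_nonneg) ?_ hlim
    filter_upwards [hclose, hδnonneg] with k hk hk'
    rw [dist_comm]
    refine abs_mean_sub_mean_le (by positivity) fun i hi => ?_
    have ht := div_natCast_mem_Icc hi
    set t := (i : ℝ) / N k
    have : x k t ^ 2 - y t ^ 2 = (x k t - y t) * ((x k t - y t) + 2 * y t) := by ring
    rw [this, abs_mul]
    have hRt : |2 * y t| ≤ 2 * R := by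
      rw [abs_mul, abs_two]
      linarith [hR t ht]
    gcongr
    · exact hk t ht
    · exact (abs_add_le _ _).trans (add_le_add (hk t ht) hRt)
  have hD : Tendsto (fun k => sumDX (N k) (x k)) l (𝓝 (y 1 - y 0)) := by
    refine ((hpoint h1).sub (hpoint h0)).congr' ?_
    filter_upwards [hNpos] with k hk
    exact (sumDX_eq hk _).symm
  have hQ : Tendsto (fun k => ∑ i ∈ Finset.range (N k),
      (x k (((i : ℝ) + 1) / N k) - x k ((i : ℝ) / N k)) ^ 2) l (𝓝 0) := by
    have hlim : Tendsto (fun k => 2 * ((|μ| + |θ| * (R + δ k)) ^ 2 * (1 / (N k : ℝ))) +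
        2 * (σ k ^ 2 * ∑ i ∈ Finset.range (N k),
          (w (((i : ℝ≥0) + 1) / N k) - w ((i : ℝ≥0) / N k)) ^ 2)) l (𝓝 0) := by
      have hN' : Tendsto (fun k => 1 / (N k : ℝ)) l (𝓝 0) :=
        tendsto_one_div_atTop_nhds_zero_nat.comp hN
      simpa using ((((((hδ0.const_add R).const_mul |θ|).const_add |μ|).pow 2).mul hN').const_mul
        2).add (((hσ0.pow 2).mul (hw.comp hN)).const_mul 2)
    refine squeeze_zero' (.of_forall fun _ => Finset.sum_nonneg fun _ _ => sq_nonneg _) ?_ hlim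
    filter_upwards [hclose, hx] with k hk hxk
    refine hxk.sum_sq_sub_le (fun t ht => ?_) (N k)
    refine (abs_add_le _ _).trans ?_
    rw [abs_mul]
    gcongr
    calc |x k t| = |y t + (x k t - y t)| := by ring_nf
      _ ≤ R + δ k := (abs_add_le _ _).trans (add_le_add (hR t ht) (hk t ht))
  have hDX : Tendsto (fun k => sumDXX (N k) (x k)) l (𝓝 ((y 1 ^ 2 - y 0 ^ 2) / 2)) := by
    have := (((((hpoint h1).pow 2).sub ((hpoint h0).pow 2)).sub hQ).div_const 2)
    rw [sub_zero] at this
    refine this.congr' ?_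
    filter_upwards [hNpos] with k hk
    exact (sumDXX_eq hk _).symm
  -- the normal equations of the limit, from `y' = μ + θ y` and `y y' = μ y + θ y ^ 2`
  have hvar := integral_sq_sub_sq_integral_pos hyc
    (exists_ne_of_hasDerivAt_ne_zero (hy 0) (by rwa [hy0]))
  have hn1 : y 1 - y 0 = μ + θ * ∫ t in (0 : ℝ)..1, y t := by
    rw [← intervalIntegral.integral_eq_sub_of_hasDerivAt (fun s _ => hy s)
      ((by fun_prop : Continuous fun s => μ + θ * y s).intervalIntegrable _ _),
      intervalIntegral.integral_add (by simp) ((hyc.const_mul θ).intervalIntegrable _ _),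
      intervalIntegral.integral_const_mul]
    simp
  have hn2 : (y 1 ^ 2 - y 0 ^ 2) / 2 =
      μ * (∫ t in (0 : ℝ)..1, y t) + θ * ∫ t in (0 : ℝ)..1, y t ^ 2 := by
    have hy2 (t : ℝ) : HasDerivAt (fun s => y s ^ 2 / 2) (μ * y t + θ * y t ^ 2) t := by
      refine (((hy t).pow 2).div_const 2).congr_deriv ?_
      push_cast
      ring
    rw [sub_div, ← intervalIntegral.integral_eq_sub_of_hasDerivAt (fun s _ => hy2 s)
      ((by fun_prop : Continuous fun s => μ * y s + θ * y s ^ 2).intervalIntegrable _ _),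
      intervalIntegral.integral_add ((hyc.const_mul μ).intervalIntegrable _ _)
        ((hyc2.const_mul θ).intervalIntegrable _ _),
      intervalIntegral.integral_const_mul, intervalIntegral.integral_const_mul]
  rw [hn1] at hD
  rw [hn2] at hDX
  generalize (∫ t in (0 : ℝ)..1, y t) = m at *
  generalize (∫ t in (0 : ℝ)..1, y t ^ 2) = q at *
  constructor
  · have hlim := (hDX.sub (hS.mul hD)).div (hSS.sub (hS.pow 2)) hvar.ne'
    have hval : (μ * m + θ * q - m * (μ + θ * m)) / (q - m ^ 2) = θ := by
      rw [div_eq_iff hvar.ne']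
      ring
    rw [hval] at hlim
    refine hlim.congr fun k => ?_
    simp only [thetaHat, Pi.div_apply]
    congr 1
    ring
  · have hlim := ((hD.mul hSS).sub (hS.mul hDX)).div (hSS.sub (hS.pow 2)) hvar.ne'
    have hval : ((μ + θ * m) * q - m * (μ * m + θ * q)) / (q - m ^ 2) = μ := by
      rw [div_eq_iff hvar.ne']
      ring
    rw [hval] at hlim
    refine hlim.congr' ?_
    filter_upwards [hNpos] with k hk
    have hk' : (N k : ℝ) ≠ 0 := by exact_mod_cast hk
    simp only [muHat, Pi.div_apply]
    rw [← mul_div_mul_left _ (sumXX (N k) (x k) - _) (one_div_ne_zero hk')]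
    congr 1 <;> ring

/-- Strong consistency of both estimators in the double limit `n → ∞`, `σ → 0+`. The process `X σ`
is a solution at noise level `σ`. The first part is the limit along arbitrary deterministic
sequences `(n, σ)`, where the exceptional null set of `X σ` may depend on `σ`. The second part is
the limit over all `n` and all `σ > 0` jointly, for a family of solutions that has one exceptional
null set (without this no almost sure statement about uncountably many `σ` could hold). -/
theorem theorem3p1 {Ω : Type*} [MeasurableSpace Ω] (P : Measure Ω) [IsProbabilityMeasure P]
    (H : ℝ) (hH : H ∈ Set.Ioo (1 / 2 : ℝ) 1)
    (S : ℝ≥0 → Ω → ℝ) (hS : IsSubfBM P H S)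
    (x₀ μ₀ θ₀ : ℝ) (hnd : μ₀ + θ₀ * x₀ ≠ 0)
    (X : ℝ → ℝ → Ω → ℝ)
    (hX : ∀ σ > 0, ∀ᵐ ω ∂P,
      IsVasicekPath x₀ μ₀ θ₀ σ (fun t => S t ω) (fun t => X σ t ω)) :
    (∀ (N : ℕ → ℕ) (s : ℕ → ℝ), Tendsto N atTop atTop → Tendsto s atTop (𝓝[>] 0) →
      (∀ᵐ ω ∂P, Tendsto (fun k => thetaHat (N k) (fun t => X (s k) t ω)) atTop (𝓝 θ₀)) ∧
      (∀ᵐ ω ∂P, Tendsto (fun k => muHat (N k) (fun t => X (s k) t ω)) atTop (𝓝 μ₀))) ∧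
    ((∀ᵐ ω ∂P, ∀ σ > 0,
        IsVasicekPath x₀ μ₀ θ₀ σ (fun t => S t ω) (fun t => X σ t ω)) →
      (∀ᵐ ω ∂P, Tendsto (fun p : ℕ × ℝ => thetaHat p.1 (fun t => X p.2 t ω))
        (atTop ×ˢ 𝓝[>] 0) (𝓝 θ₀)) ∧
      (∀ᵐ ω ∂P, Tendsto (fun p : ℕ × ℝ => muHat p.1 (fun t => X p.2 t ω))
        (atTop ×ˢ 𝓝[>] 0) (𝓝 μ₀))) := by
  have hqv := hS.ae_tendsto_sum_sq_sub hH.1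
  refine ⟨fun N s hN hs => ?_, fun hall => ?_⟩
  · -- only countably many noise levels occur, so their exceptional sets can be merged
    have hpath : ∀ᵐ ω ∂P, ∀ k, 0 < s k →
        IsVasicekPath x₀ μ₀ θ₀ (s k) (fun t => S t ω) (fun t => X (s k) t ω) :=
      ae_all_iff.2 fun k => by
        by_cases hk : 0 < s k
        · exact (hX _ hk).mono fun ω h _ => h
        · exact .of_forall fun ω h => absurd h hk
    have hmain : ∀ᵐ ω ∂P,
        Tendsto (fun k => thetaHat (N k) (fun t => X (s k) t ω)) atTop (𝓝 θ₀) ∧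
        Tendsto (fun k => muHat (N k) (fun t => X (s k) t ω)) atTop (𝓝 μ₀) := by
      filter_upwards [hqv, hpath] with ω hω hp
      exact tendsto_thetaHat_muHat hnd (w := fun t => S t ω) hω hN hs
        ((hs.eventually self_mem_nhdsWithin).mono fun k hk => hp k hk)
    exact ⟨hmain.mono fun _ h => h.1, hmain.mono fun _ h => h.2⟩
  · have hmain : ∀ᵐ ω ∂P,
        Tendsto (fun p : ℕ × ℝ => thetaHat p.1 (fun t => X p.2 t ω))
          (atTop ×ˢ 𝓝[>] 0) (𝓝 θ₀) ∧
        Tendsto (fun p : ℕ × ℝ => muHat p.1 (fun t => X p.2 t ω))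
          (atTop ×ˢ 𝓝[>] 0) (𝓝 μ₀) := by
      filter_upwards [hqv, hall] with ω hω hp
      exact tendsto_thetaHat_muHat hnd (w := fun t => S t ω) (x := fun p t => X p.2 t ω)
        hω tendsto_fst tendsto_snd
        ((tendsto_snd.eventually self_mem_nhdsWithin).mono fun p hp' => hp p.2 hp')
    exact ⟨hmain.mono fun _ h => h.1, hmain.mono fun _ h => h.2⟩
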